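/- Let $U\subset\mathbb R^m$ be compact, $f:\mathbb R^n\times U\to\mathbb R^n$, $\sigma:\mathbb R^n\times U\to M(n,d)$ (the $n\times d$ real matrices) and $l:\mathbb R^n\times U\to\mathbb R$. Assume that $f,\sigma,l$ are of class $C^1$ on $\mathbb R^n\times U$, that $f,\sigma$ and their derivatives $f_x,\sigma_x$ in $x$ are bounded on $\mathbb R^n\times U$, and that $l,l_x,l_u$ are bounded on $\mathbb R^n\times U$. Let $T>0$. For $0\le t<r\le T$ let $\Gamma(t,r)$ be the set of maps $\alpha:L^2([t,r];\mathbb R^d)\to L^\infty([t,r];U)$ such that (S1) for every $v$ the function $s\mapsto\alpha[v](s)$ is right-continuous with left limits on $[t,r]$; (S2) if $v=\tilde v$ a.e. on $[t,s]$ for some $s\in[t,r]$, then $\alpha[v](\tau)=\alpha[\tilde v](\tau)$ for all $\tau\in[t,s]$. For $\phi:\mathbb R^n\to\mathbb R\cup\{-\infty\}$ and $x\in\mathbb R^n$ put $$F_{t,r}\phi(x)=\inf_{\alpha\in\Gamma(t,r)}\ \sup_{v\in L^2([t,r];\mathbb R^d)}\Big\{\max\Big(\operatorname*{ess\,sup}_{t\le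 s\le r}l(x(s),\alpha[v](s)),\ \phi(x(r))\Big)-\frac12\int_t^r|v(s)|^2\,ds\Big\},$$ where $x(\cdot)$ is the unique solution of $$\frac{dx}{ds}(s)=f(x(s),\alpha[v](s))+\sigma(x(s),\alpha[v](s))v(s),\quad t\le s\le r,\qquad x(t)=x,$$ and let $F_{t,t}$ be the identity. For $x,p\in\mathbb R^n$, $r\in\mathbb R$ and $u\in U$ let $$H^u(x,p)=\max_{v\in\mathbb R^d}\Big\{(f(x,u)+\sigma(x,u)v)\cdot p-\frac12|v|^2\Big\},\qquad A(x,r)=\{u\in U: l(x,u)\le r\},$$ $$\mathcal H(x,r,p)=\min_{u\in A(x,r)}H^u(x,p),\qquad \mathcal H(x,r,p)=+\infty\ \text{ if }A(x,r)=\emptyset,$$ and let $\mathcal H^*(\xi)=\limsup_{\eta\to\xi}\mathcal H(\eta)$ and $\mathcal H_*(\xi)=\liminf_{\eta\to\xi}\mathcal H(\eta)$, for $\xi\in\mathbb R^n\times\mathbb R\times\mathbb R^n$, be the upper and lower semicontinuous envelopes of $\mathcal H$ in $(x,r,p)$, with values in $[-\infty,+\infty]$. Then for every bounded $C^1$ function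 $\varphi:(0,T)\times\mathbb R^n\to\mathbb R$ with bounded first order derivatives and every $(t,x)\in(0,T)\times\mathbb R^n$, $$\limsup_{\delta\to0+}\frac1\delta\big\{F_{t,t+\delta}\varphi(t+\delta,\cdot)(x)-\varphi(t,x)\big\}\le\frac{\partial\varphi}{\partial t}(t,x)+\mathcal H^*(x,\varphi(t,x),\nabla\varphi(t,x)),$$ $$\frac{\partial\varphi}{\partial t}(t,x)+\mathcal H_*(x,\varphi(t,x),\nabla\varphi(t,x))\le\liminf_{\delta\to0+}\frac1\delta\big\{F_{t,t+\delta}\varphi(t+\delta,\cdot)(x)-\varphi(t,x)\big\},$$ as inequalities in $[-\infty,+\infty]$. -/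

import Mathlib

open Set Filter Topology MeasureTheory
open scoped Gradient

noncomputable section

namespace MaxPlus

/-- The Euclidean space `ℝᵏ`. -/
abbrev E (k : ℕ) : Type := EuclideanSpace ℝ (Fin k)

/-- The space `L²([t,r]; ℝᵈ)` of disturbances. -/
abbrev L2 (d : ℕ) (t r : ℝ) : Type := Lp (E d) 2 (volume.restrict (Icc t r))

/-- The data of the control problem: the control set `U ⊆ ℝᵐ`, the drift `f`, the disturbance
coefficient `σ` (an `n × d` matrix, seen as a linear map `ℝᵈ → ℝⁿ`) and the running cost `l`.
Only the values of `f`, `σ`, `l` at controls in `U` are ever used. -/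
structure Data (n m d : ℕ) where
  U : Set (E m)
  f : E n → E m → E n
  σ : E n → E m → (E d →L[ℝ] E n)
  l : E n → E m → ℝ

/-- `g` is `C¹` on `ℝⁿ × U`, with continuous partial derivatives `gx` in the state and `gu` in the
control. -/
structure HasC1Partials {n m : ℕ} {G : Type*} [NormedAddCommGroup G] [NormedSpace ℝ G]
    (U : Set (E m)) (g : E n → E m → G)
    (gx : E n → E m → (E n →L[ℝ] G)) (gu : E n → E m → (E m →L[ℝ] G)) : Prop where
  hasFDeriv : ∀ x : E n, ∀ u ∈ U,
    HasFDerivWithinAt (Function.uncurry g) ((gx x u).coprod (gu x u)) (univ ×ˢ U) (x, u)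
  continuousOn_x : ContinuousOn (Function.uncurry gx) (univ ×ˢ U)
  continuousOn_u : ContinuousOn (Function.uncurry gu) (univ ×ˢ U)

/-- `g` is bounded on `ℝⁿ × U`. -/
def BoundedOnU {n m : ℕ} {G : Type*} [NormedAddCommGroup G]
    (U : Set (E m)) (g : E n → E m → G) : Prop :=
  ∃ C : ℝ, ∀ x : E n, ∀ u ∈ U, ‖g x u‖ ≤ C

/-- The standing assumptions: `U` is compact; `f`, `σ` are `C¹` on `ℝⁿ × U` and `f`, `σ`, `f_x`,
`σ_x` are bounded there; `l` is `C¹` on `ℝⁿ × U` and `l`, `l_x`, `l_u` are bounded there. -/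
structure Data.Standing {n m d : ℕ} (D : Data n m d) : Prop where
  compact_U : IsCompact D.U
  f_C1 : ∃ fx fu, HasC1Partials D.U D.f fx fu ∧ BoundedOnU D.U fx
  f_bdd : BoundedOnU D.U D.f
  σ_C1 : ∃ σx σu, HasC1Partials D.U D.σ σx σu ∧ BoundedOnU D.U σx
  σ_bdd : BoundedOnU D.U D.σ
  l_C1 : ∃ lx lu, HasC1Partials D.U D.l lx lu ∧ BoundedOnU D.U lx ∧ BoundedOnU D.U lu
  l_bdd : BoundedOnU D.U D.l

variable {n m d : ℕ}

/-- The right-hand side `f(x(s),u(s)) + σ(x(s),u(s)) v(s)` of the state equation. -/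
def Data.velocity (D : Data n m d) (X : ℝ → E n) (u : ℝ → E m) (v : ℝ → E d) (s : ℝ) : E n :=
  D.f (X s) (u s) + D.σ (X s) (u s) (v s)

/-- `X` is the (Carathéodory) solution on `[t,r]` of
`dX/ds = f(X(s),u(s)) + σ(X(s),u(s)) v(s)`, `X(t) = x`. -/
structure Data.IsTrajectory (D : Data n m d) (t r : ℝ) (x : E n) (u : ℝ → E m) (v : ℝ → E d)
    (X : ℝ → E n) : Prop where
  continuousOn : ContinuousOn X (Icc t r)
  integrableOn : IntegrableOn (D.velocity X u v) (Icc t r)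
  eq_integral : ∀ s ∈ Icc t r, X s = x + ∫ τ in t..s, D.velocity X u v τ

/-- The class `Γ(t,r)` of strategies `α : L²([t,r];ℝᵈ) → L^∞([t,r];U)`: every `α[v]` is
right-continuous with left limits on `[t,r]`, and if `v = w` a.e. on `[t,s]`, then
`α[v] = α[w]` everywhere on `[t,s]`. -/
structure Data.IsStrategy (D : Data n m d) (t r : ℝ) (α : L2 d t r → ℝ → E m) : Prop where
  mem_U : ∀ v, ∀ s ∈ Icc t r, α v s ∈ D.U
  memLp_top : ∀ v, MemLp (α v) ⊤ (volume.restrict (Icc t r))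
  right_continuous : ∀ v, ∀ s ∈ Icc t r, ContinuousWithinAt (α v) (Icc s r) s
  left_limits : ∀ v, ∀ s ∈ Ioc t r, ∃ a : E m, Tendsto (α v) (𝓝[<] s) (𝓝 a)
  nonanticipating : ∀ v w : L2 d t r, ∀ s ∈ Icc t r,
    (∀ᵐ τ ∂(volume.restrict (Icc t s)), v τ = w τ) → ∀ τ ∈ Icc t s, α v τ = α w τ

/-- The max-plus expectation `E⁺[Z] = sup_v { Z(v) - ½ ∫_t^r |v(s)|² ds }`, the supremum being
over `v ∈ L²([t,r];ℝᵈ)`. -/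
def maxPlusExp (t r : ℝ) (Z : L2 d t r → EReal) : EReal :=
  ⨆ v : L2 d t r, Z v + ((-(1 / 2 * ∫ s in Icc t r, ‖v s‖ ^ 2) : ℝ) : EReal)

/-- The random variable `v ↦ ∫^⊕_{[t,r]} l(x(s),α[v](s)) ds ⊕ φ(x(r))`, the maximum of
`ess sup_{t ≤ s ≤ r} l(x(s),α[v](s))` and `φ(x(r))`, where `x(·)` is the trajectory started from
`x(t) = x` with control `α[v]` and disturbance `v`. Under the standing assumptions there is exactly
one trajectory on `[t,r]`, and the supremum over `X` merely inserts it. -/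
def Data.cost (D : Data n m d) (t r : ℝ) (φ : E n → EReal) (x : E n)
    (α : L2 d t r → ℝ → E m) (v : L2 d t r) : EReal :=
  ⨆ (X : ℝ → E n) (_ : D.IsTrajectory t r x (α v) v X),
    max (essSup (fun s => (D.l (X s) (α v s) : EReal)) (volume.restrict (Icc t r))) (φ (X r))

open Classical in
/-- The two-parameter family `F_{t,r}`: for `t < r`,
`F_{t,r} φ (x) = inf_{α ∈ Γ(t,r)} E⁺_{tx}[ ∫^⊕_{[t,r]} l(x(s),α[v](s)) ds ⊕ φ(x(r)) ]`,
and `F_{t,t}` is the identity. -/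
def Data.F (D : Data n m d) (t r : ℝ) (φ : E n → EReal) (x : E n) : EReal :=
  if t = r then φ x
  else ⨅ (α : L2 d t r → ℝ → E m) (_ : D.IsStrategy t r α), maxPlusExp t r (D.cost t r φ x α)

/-- `H^u(x,p) = max_{v ∈ ℝᵈ} { (f(x,u) + σ(x,u)v)·p - ½|v|² }`. -/
def Data.Hu (D : Data n m d) (u : E m) (x p : E n) : EReal :=
  ⨆ v : E d, ((inner ℝ (D.f x u + D.σ x u v) p - 1 / 2 * ‖v‖ ^ 2 : ℝ) : EReal)

/-- `A(x,r) = { u ∈ U : l(x,u) ≤ r }`. -/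
def Data.A (D : Data n m d) (x : E n) (r : ℝ) : Set (E m) := {u ∈ D.U | D.l x u ≤ r}

/-- `ℋ(x,r,p) = min_{u ∈ A(x,r)} H^u(x,p)`, with value `+∞` if `A(x,r)` is empty; the argument is
the triple `(x,r,p) ∈ ℝⁿ × ℝ × ℝⁿ`. -/
def Data.H (D : Data n m d) (ξ : E n × ℝ × E n) : EReal :=
  ⨅ u ∈ D.A ξ.1 ξ.2.1, D.Hu u ξ.1 ξ.2.2

/-- The upper semicontinuous envelope `h^*(ξ) = limsup_{η → ξ} h(η)`. -/
def upperEnvelope {X : Type*} [TopologicalSpace X] (h : X → EReal) (ξ : X) : EReal :=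
  limsup h (𝓝 ξ)

/-- The lower semicontinuous envelope `h_*(ξ) = liminf_{η → ξ} h(η)`. -/
def lowerEnvelope {X : Type*} [TopologicalSpace X] (h : X → EReal) (ξ : X) : EReal :=
  liminf h (𝓝 ξ)

/-- `φ ∈ C¹_b((0,T) × ℝⁿ)`: `φ` is `C¹` on `(0,T) × ℝⁿ`, bounded, with bounded first order
derivatives. -/
structure IsC1b (T : ℝ) (φ : ℝ → E n → ℝ) : Prop where
  contDiffOn : ContDiffOn ℝ 1 (Function.uncurry φ) (Ioo 0 T ×ˢ univ)
  bdd : ∃ C : ℝ, ∀ t ∈ Ioo 0 T, ∀ x, |φ t x| ≤ C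
  deriv_bdd : ∃ C : ℝ, ∀ t ∈ Ioo 0 T, ∀ x, |deriv (fun s => φ s x) t| ≤ C
  grad_bdd : ∃ C : ℝ, ∀ t ∈ Ioo 0 T, ∀ x, ‖∇ (φ t) x‖ ≤ C

/-- The difference quotient `δ⁻¹ { F_{t,t+δ} φ(t+δ,·)(x) - φ(t,x) }`. -/
def Data.quotient (D : Data n m d) (φ : ℝ → E n → ℝ) (t : ℝ) (x : E n) (δ : ℝ) : EReal :=
  ((δ⁻¹ : ℝ) : EReal) * (D.F t (t + δ) (fun y => (φ (t + δ) y : EReal)) x - (φ t x : EReal))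

end MaxPlus

end

/-! Write `p` for the gradient and `q` for the time derivative of `φ` at `(t,x)`. Over a short
interval, `φ(t+δ, X(t+δ))` minus the energy equals `φ(t,x) + δ q` plus the integral of `(f + σ v)·p
- ½|v|²`, up to `o(δ)` when the displacement is `O(δ)`. The envelopes of `ℋ` are used only by moving
the level `r = φ(t,x)`, which leaves room of fixed size in the constraint `l ≤ r`.

Upper bound (`Data.eventually_F_le`). If `ℋ^* < c`, some `u` with `l(x,u)` strictly below `φ(t,x)`
has `H^u ≤ c`; it is played as a constant strategy. The running cost then stays harmless for small
`δ`. Since disturbances are unbounded, those of energy at least `R δ` are handled separately: their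
energy penalty outweighs the at most linear growth of `φ`. The others move the state by `O(δ)`, so
coefficients may be frozen at `x`.

Lower bound (`Data.eventually_le_F`). If `c < ℋ_*`, every `u` with `l(x,u)` at most slightly above
`φ(t,x)` has `H^u > c`. Against any strategy `α`, the maximizing disturbance would be the feedback
`v = σ(x,α[v])ᵀp`. This is circular, but nonanticipation and right-continuity allow it to be solved
up to `ε` (`Data.IsStrategy.exists_near_feedback`). Then either the running cost alone exceeds
`φ(t,x)` by a fixed amount, or the constraint nearly holds almost everywhere and the integrand is at
least `c` up to small errors. -/

namespace MaxPlus

/-! ### Short-time existence for equations measurable in time -/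

section Caratheodory

variable {G : Type*} [NormedAddCommGroup G] [NormedSpace ℝ G] [CompleteSpace G]

/-- Short-time existence for the integral equation `X = x + ∫ b(X(τ), τ) dτ` with a right-hand side
that is only measurable in time. -/
theorem exists_integral_solution {t r B K : ℝ} (htr : t ≤ r) (hK : 0 ≤ K)
    (b : G → ℝ → G) (x : G)
    (hmeas : ∀ X : ℝ → G, Continuous X →
      AEStronglyMeasurable (fun τ => b (X τ) τ) (volume.restrict (Icc t r)))
    (hbdd : ∀ᵐ τ ∂(volume.restrict (Icc t r)), ∀ y, ‖b y τ‖ ≤ B)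
    (hlip : ∀ᵐ τ ∂(volume.restrict (Icc t r)), ∀ y z, ‖b y τ - b z τ‖ ≤ K * ‖y - z‖)
    (hsmall : K * (r - t) < 1) :
    ∃ X : ℝ → G, Continuous X ∧ IntegrableOn (fun τ => b (X τ) τ) (Icc t r) ∧
      ∀ s ∈ Icc t r, X s = x + ∫ τ in t..s, b (X τ) τ := by
  have hint : ∀ X : ℝ → G, Continuous X → IntegrableOn (fun τ => b (X τ) τ) (Icc t r) := by
    intro X hX
    refine Integrable.of_bound (hmeas X hX) B ?_
    filter_upwards [hbdd] with τ hτ using hτ _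
  have hii : ∀ X : ℝ → G, Continuous X → ∀ s ∈ Icc t r,
      IntervalIntegrable (fun τ => b (X τ) τ) volume t s := by
    intro X hX s hs
    rw [intervalIntegrable_iff_integrableOn_Icc_of_le hs.1]
    exact (hint X hX).mono_set (Icc_subset_Icc_right hs.2)
  have hext : ∀ X : C(Icc t r, G), Continuous (IccExtend htr X) := fun X =>
    X.continuous.Icc_extend'
  have hcont : ∀ X : ℝ → G, Continuous X →
      ContinuousOn (fun s => x + ∫ τ in t..s, b (X τ) τ) (Icc t r) := by
    intro X hX
    refine continuousOn_const.add ?_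
    have := intervalIntegral.continuousOn_primitive_interval (a := t) (b := r) (μ := volume)
      (f := fun τ => b (X τ) τ) (by rw [uIcc_of_le htr]; exact hint X hX)
    rwa [uIcc_of_le htr] at this
  let P : C(Icc t r, G) → C(Icc t r, G) := fun X =>
    ⟨(Icc t r).domRestrict (fun s => x + ∫ τ in t..s, b (IccExtend htr X τ) τ),
      (hcont _ (hext X)).domRestrict⟩
  -- In the sup norm the Picard map has Lipschitz constant `K * (r - t)`, which is why the interval
  -- must be short.
  have hP : ContractingWith (K * (r - t)).toNNReal P := by
    refine ⟨by simpa [Real.toNNReal_lt_one] using hsmall, LipschitzWith.of_dist_le_mul ?_⟩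
    intro X Y
    have hKr : 0 ≤ K * (r - t) := mul_nonneg hK (sub_nonneg.2 htr)
    rw [Real.coe_toNNReal _ hKr]
    rw [ContinuousMap.dist_le (mul_nonneg hKr dist_nonneg)]
    intro s
    have e : P X s - P Y s
        = ∫ τ in t..s, (b (IccExtend htr X τ) τ - b (IccExtend htr Y τ) τ) := by
      rw [intervalIntegral.integral_sub (hii _ (hext X) s s.2) (hii _ (hext Y) s s.2)]
      exact add_sub_add_left_eq_sub _ _ _
    rw [dist_eq_norm, e]
    have h1 : ∀ᵐ τ : ℝ, τ ∈ uIoc t (s : ℝ) →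
        ‖b (IccExtend htr X τ) τ - b (IccExtend htr Y τ) τ‖ ≤ K * dist X Y := by
      rw [ae_restrict_iff' measurableSet_Icc] at hlip
      filter_upwards [hlip] with τ hτ hmem
      rw [uIoc_of_le s.2.1] at hmem
      refine (hτ ⟨hmem.1.le, hmem.2.trans s.2.2⟩ _ _).trans ?_
      refine mul_le_mul_of_nonneg_left ?_ hK
      rw [← dist_eq_norm]
      exact ContinuousMap.dist_apply_le_dist _
    refine (intervalIntegral.norm_integral_le_of_norm_le_const_ae h1).trans ?_
    rw [abs_of_nonneg (sub_nonneg.2 s.2.1), mul_assoc, mul_assoc, mul_comm (r - t)]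
    gcongr
    exact s.2.2
  have : Nonempty C(Icc t r, G) := ⟨ContinuousMap.const _ x⟩
  let Y := ContractingWith.fixedPoint P hP
  have hY : P Y = Y := hP.fixedPoint_isFixedPt
  refine ⟨IccExtend htr Y, hext Y, hint _ (hext Y), fun s hs => ?_⟩
  have := congrArg (fun Z : C(Icc t r, G) => Z ⟨s, hs⟩) hY
  rw [IccExtend_of_mem _ _ hs]
  exact this.symm

end Caratheodory

variable {n m d : ℕ}

/-! ### Uniform bounds and Lipschitz constants; existence of trajectories -/

section C1

variable {G : Type*} [NormedAddCommGroup G] [NormedSpace ℝ G] {U : Set (E m)}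
  {g : E n → E m → G} {gx : E n → E m → (E n →L[ℝ] G)} {gu : E n → E m → (E m →L[ℝ] G)}

theorem HasC1Partials.continuousOn (h : HasC1Partials U g gx gu) :
    ContinuousOn (Function.uncurry g) (univ ×ˢ U) := fun z hz =>
  (h.hasFDeriv z.1 z.2 hz.2).continuousWithinAt

theorem HasC1Partials.hasFDerivAt_state (h : HasC1Partials U g gx gu) {u : E m} (hu : u ∈ U)
    (x : E n) : HasFDerivAt (fun y => g y u) (gx x u) x := by
  have h1 : HasFDerivWithinAt (fun y : E n => (y, u)) (ContinuousLinearMap.inl ℝ (E n) (E m))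
      univ x := (hasFDerivAt_prodMk_left x u).hasFDerivWithinAt
  have hm : MapsTo (fun y : E n => (y, u)) univ (univ ×ˢ U) := fun y _ => ⟨mem_univ _, hu⟩
  have h2 := ((h.hasFDeriv x u hu).comp x h1 hm).hasFDerivAt univ_mem
  rw [ContinuousLinearMap.coprod_comp_inl] at h2
  exact h2

theorem HasC1Partials.exists_lipschitz (h : HasC1Partials U g gx gu) (hb : BoundedOnU U gx) :
    ∃ C : ℝ, ∀ u ∈ U, ∀ x y : E n, ‖g x u - g y u‖ ≤ C * ‖x - y‖ := by
  obtain ⟨C, hC⟩ := hb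
  refine ⟨C, fun u hu x y => ?_⟩
  exact convex_univ.norm_image_sub_le_of_norm_hasFDerivWithin_le (f := fun y => g y u)
    (fun z _ => (h.hasFDerivAt_state hu z).hasFDerivWithinAt) (fun z _ => hC z u hu)
    (mem_univ y) (mem_univ x)

end C1

/-- `M` bounds `f`, `σ` and is a Lipschitz constant in the state for `f`, `σ`, `l`, uniformly over
the controls in `U`. -/
structure Data.BoundedBy (D : Data n m d) (M : ℝ) : Prop where
  pos : 0 < M
  f_le : ∀ x, ∀ u ∈ D.U, ‖D.f x u‖ ≤ M
  σ_le : ∀ x, ∀ u ∈ D.U, ‖D.σ x u‖ ≤ M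
  f_lip : ∀ u ∈ D.U, ∀ x y, ‖D.f x u - D.f y u‖ ≤ M * ‖x - y‖
  σ_lip : ∀ u ∈ D.U, ∀ x y, ‖D.σ x u - D.σ y u‖ ≤ M * ‖x - y‖
  l_lip : ∀ u ∈ D.U, ∀ x y, |D.l x u - D.l y u| ≤ M * ‖x - y‖

theorem Data.Standing.exists_boundedBy {D : Data n m d} (hD : D.Standing) :
    ∃ M, D.BoundedBy M := by
  obtain ⟨fx, fu, hf, hfx⟩ := hD.f_C1
  obtain ⟨σx, σu, hσ, hσx⟩ := hD.σ_C1
  obtain ⟨lx, lu, hl, hlx, -⟩ := hD.l_C1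
  obtain ⟨a, ha⟩ := hD.f_bdd
  obtain ⟨b, hb⟩ := hD.σ_bdd
  obtain ⟨a', ha'⟩ := hf.exists_lipschitz hfx
  obtain ⟨b', hb'⟩ := hσ.exists_lipschitz hσx
  obtain ⟨c', hc'⟩ := hl.exists_lipschitz hlx
  have h1 := le_abs_self a
  have h2 := le_abs_self b
  have h3 := le_abs_self a'
  have h4 := le_abs_self b'
  have h5 := le_abs_self c'
  have k1 := abs_nonneg a
  have k2 := abs_nonneg b
  have k3 := abs_nonneg a'
  have k4 := abs_nonneg b'
  have k5 := abs_nonneg c'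
  refine ⟨|a| + |b| + |a'| + |b'| + |c'| + 1, by linarith, fun x u hu => ?_, fun x u hu => ?_,
    fun u hu x y => ?_, fun u hu x y => ?_, fun u hu x y => ?_⟩
  · linarith [ha x u hu]
  · linarith [hb x u hu]
  · exact (ha' u hu x y).trans (mul_le_mul_of_nonneg_right (by linarith) (norm_nonneg _))
  · exact (hb' u hu x y).trans (mul_le_mul_of_nonneg_right (by linarith) (norm_nonneg _))
  · exact (hc' u hu x y).trans (mul_le_mul_of_nonneg_right (by linarith) (norm_nonneg _))

theorem Data.BoundedBy.velocity_le {D : Data n m d} {M : ℝ} (hM : D.BoundedBy M) {u : E m}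
    (hu : u ∈ D.U) (y : E n) (v : E d) : ‖D.f y u + D.σ y u v‖ ≤ M * (1 + ‖v‖) := by
  have h1 := hM.f_le y u hu
  have h2 := (D.σ y u).le_of_opNorm_le (hM.σ_le y u hu) v
  linarith [norm_add_le (D.f y u) (D.σ y u v)]

theorem Data.BoundedBy.velocity_sub_le {D : Data n m d} {M : ℝ} (hM : D.BoundedBy M) {u : E m}
    (hu : u ∈ D.U) (y z : E n) (v : E d) :
    ‖(D.f y u + D.σ y u v) - (D.f z u + D.σ z u v)‖ ≤ M * (1 + ‖v‖) * ‖y - z‖ := by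
  have h1 := hM.f_lip u hu y z
  have h2 := (D.σ y u - D.σ z u).le_of_opNorm_le (hM.σ_lip u hu y z) v
  have e : (D.f y u + D.σ y u v) - (D.f z u + D.σ z u v)
      = (D.f y u - D.f z u) + (D.σ y u - D.σ z u) v := by
    simp only [sub_apply]; abel
  rw [e]
  linarith [norm_add_le (D.f y u - D.f z u) ((D.σ y u - D.σ z u) v)]

/-- Continuity of `f` and `σ` is available only over the closed set `D.U`. Extending by zero outside
gives a Borel function on the whole space, which can be composed with the measurable triple of
state, control and disturbance. -/
theorem Data.Standing.aestronglyMeasurable_velocity {D : Data n m d} (hD : D.Standing) {t r : ℝ}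
    {u : ℝ → E m} {v : ℝ → E d} {X : ℝ → E n} (hu : ∀ s ∈ Icc t r, u s ∈ D.U)
    (hum : AEStronglyMeasurable u (volume.restrict (Icc t r)))
    (hv : AEStronglyMeasurable v (volume.restrict (Icc t r))) (hX : Continuous X) :
    AEStronglyMeasurable (D.velocity X u v) (volume.restrict (Icc t r)) := by
  classical
  obtain ⟨fx, fu, hf, -⟩ := hD.f_C1
  obtain ⟨σx, σu, hσ, -⟩ := hD.σ_C1
  let S : Set ((E n × E m) × E d) := (univ ×ˢ D.U) ×ˢ univ
  let Φ : (E n × E m) × E d → E n := fun z => D.f z.1.1 z.1.2 + D.σ z.1.1 z.1.2 z.2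
  have hS : MeasurableSet S :=
    (((isClosed_univ.prod hD.compact_U.isClosed)).prod isClosed_univ).measurableSet
  have hΦ : ContinuousOn Φ S := by
    have m1 : MapsTo (Prod.fst : (E n × E m) × E d → E n × E m) S (univ ×ˢ D.U) :=
      fun z hz => hz.1
    exact (hf.continuousOn.comp continuousOn_fst m1).add
      ((hσ.continuousOn.comp continuousOn_fst m1).clm_apply continuousOn_snd)
  have hmeas : Measurable (S.piecewise Φ 0) :=
    hΦ.measurable_piecewise continuousOn_const hS
  have hpair : AEMeasurable (fun s => ((X s, u s), v s)) (volume.restrict (Icc t r)) :=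
    (hX.measurable.aemeasurable.prodMk hum.aemeasurable).prodMk hv.aemeasurable
  refine (hmeas.comp_aemeasurable hpair).aestronglyMeasurable.congr ?_
  filter_upwards [ae_restrict_mem measurableSet_Icc] with s hs
  have : ((X s, u s), v s) ∈ S := ⟨⟨mem_univ _, hu s hs⟩, mem_univ _⟩
  exact piecewise_eq_of_mem _ _ _ this

theorem Data.Standing.exists_trajectory {D : Data n m d} (hD : D.Standing) {M V t r : ℝ}
    (hM : D.BoundedBy M) (hV : 0 ≤ V) (htr : t ≤ r) (hsmall : M * (1 + V) * (r - t) < 1)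
    {u : ℝ → E m} {v : ℝ → E d} (hu : ∀ s ∈ Icc t r, u s ∈ D.U)
    (hum : AEStronglyMeasurable u (volume.restrict (Icc t r)))
    (hv : AEStronglyMeasurable v (volume.restrict (Icc t r)))
    (hvb : ∀ᵐ s ∂(volume.restrict (Icc t r)), ‖v s‖ ≤ V) (x : E n) :
    ∃ X, D.IsTrajectory t r x u v X := by
  have hMpos := hM.pos
  have hMV : 0 ≤ M * (1 + V) := by positivity
  obtain ⟨X, hX, hi, he⟩ := exists_integral_solution (B := M * (1 + V)) htr hMV
    (fun y τ => D.f y (u τ) + D.σ y (u τ) (v τ)) x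
    (fun X hX => hD.aestronglyMeasurable_velocity hu hum hv hX)
    (by
      filter_upwards [hvb, ae_restrict_mem measurableSet_Icc] with τ h1 h2 y
      exact (hM.velocity_le (hu τ h2) y (v τ)).trans (by gcongr))
    (by
      filter_upwards [hvb, ae_restrict_mem measurableSet_Icc] with τ h1 h2 y z
      exact (hM.velocity_sub_le (hu τ h2) y z (v τ)).trans (by gcongr))
    hsmall
  exact ⟨X, hX.continuousOn, hi, he⟩

/-! ### Displacement and energy along a trajectory -/

section Trajectory

variable {D : Data n m d} {M t r : ℝ} {x : E n} {u : ℝ → E m} {v : ℝ → E d} {X : ℝ → E n}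

theorem Data.IsTrajectory.norm_sub_le (h : D.IsTrajectory t r x u v X) (hM : D.BoundedBy M)
    (hu : ∀ s ∈ Icc t r, u s ∈ D.U) (hv : IntegrableOn (fun s => ‖v s‖) (Icc t r))
    {s : ℝ} (hs : s ∈ Icc t r) :
    ‖X s - x‖ ≤ M * ((r - t) + ∫ τ in Icc t r, ‖v τ‖) := by
  have hMpos := hM.pos
  have htr : t ≤ r := hs.1.trans hs.2
  have hsub : Ioc t s ⊆ Icc t r := fun τ hτ => ⟨hτ.1.le, hτ.2.trans hs.2⟩
  have h1 : Integrable (fun _ : ℝ => (1 : ℝ)) (volume.restrict (Icc t r)) :=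
    integrable_const _
  have hint : IntegrableOn (fun τ => M * (1 + ‖v τ‖)) (Icc t r) := (h1.add hv).const_mul M
  rw [h.eq_integral s hs, add_sub_cancel_left, intervalIntegral.integral_of_le hs.1]
  calc ‖∫ τ in Ioc t s, D.velocity X u v τ‖
      ≤ ∫ τ in Ioc t s, M * (1 + ‖v τ‖) := by
        refine norm_integral_le_of_norm_le (hint.mono_set hsub) ?_
        filter_upwards [ae_restrict_mem measurableSet_Ioc] with τ hτ
        exact hM.velocity_le (hu τ (hsub hτ)) _ _
    _ ≤ ∫ τ in Icc t r, M * (1 + ‖v τ‖) := by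
        refine setIntegral_mono_set hint ?_ hsub.eventuallyLE
        filter_upwards with τ
        positivity
    _ = M * ((r - t) + ∫ τ in Icc t r, ‖v τ‖) := by
        rw [integral_const_mul, integral_add h1 hv]
        simp [htr]

theorem Data.IsTrajectory.integrable_inner_sub_energy (h : D.IsTrajectory t r x u v X)
    (hv : IntegrableOn (fun s => ‖v s‖ ^ 2) (Icc t r)) (p : E n) :
    IntegrableOn (fun s => inner ℝ (D.velocity X u v s) p - 1 / 2 * ‖v s‖ ^ 2) (Icc t r) := by
  refine Integrable.sub ?_ (hv.const_mul _)
  exact h.integrableOn.inner_const p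

/-- Turns the first-order gain minus the energy into an integral of the expression maximized in
`Data.Hu`, so that both bounds reduce to pointwise estimates. -/
theorem Data.IsTrajectory.inner_sub_energy (h : D.IsTrajectory t r x u v X) (htr : t ≤ r)
    (hv : IntegrableOn (fun s => ‖v s‖ ^ 2) (Icc t r)) (p : E n) :
    inner ℝ (X r - x) p - 1 / 2 * ∫ s in Icc t r, ‖v s‖ ^ 2 =
      ∫ s in Icc t r, (inner ℝ (D.velocity X u v s) p - 1 / 2 * ‖v s‖ ^ 2) := by
  rw [integral_sub (h.integrableOn.inner_const p) (hv.const_mul _), integral_const_mul,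
    h.eq_integral r ⟨htr, le_rfl⟩, add_sub_cancel_left, intervalIntegral.integral_of_le htr,
    ← integral_Icc_eq_integral_Ioc, real_inner_comm, ← integral_inner h.integrableOn]
  simp_rw [real_inner_comm]

end Trajectory

/-! ### Approximate feedback disturbances against a strategy -/

/-- A monotone family of disturbances, each extending the previous ones, has a common extension. -/
theorem exists_common_extension {t r V : ℝ} (s : ℕ → ℝ) (hs : ∀ k, s k ∈ Icc t r)
    (hmono : Monotone s) (v : ℕ → L2 d t r)
    (hV : ∀ k, ∀ᵐ τ ∂(volume.restrict (Icc t (s k))), ‖v k τ‖ ≤ V)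
    (hv : ∀ j k, j ≤ k → ∀ᵐ τ ∂(volume.restrict (Icc t (s j))), v j τ = v k τ) :
    ∃ w : L2 d t r, ∀ k, ∀ᵐ τ ∂(volume.restrict (Icc t (s k))), v k τ = w τ := by
  have hsub : ∀ k, Icc t (s k) ⊆ Icc t r := fun k => Icc_subset_Icc_right (hs k).2
  -- Cut off by zero, the sequence is almost everywhere eventually constant or identically zero. Its
  -- limit is therefore measurable, and the uniform bound `V` puts it in `L²`.
  let F : ℕ → ℝ → E d := fun k => (Icc t (s k)).indicator (v k)
  have hFm : ∀ k, AEStronglyMeasurable (F k) (volume.restrict (Icc t r)) := fun k =>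
    (Lp.aestronglyMeasurable (v k)).indicator measurableSet_Icc
  have hall : ∀ᵐ τ : ℝ, ∀ j k, j ≤ k → τ ∈ Icc t (s j) → v j τ = v k τ := by
    rw [ae_all_iff]; intro j
    rw [ae_all_iff]; intro k
    by_cases hjk : j ≤ k
    · filter_upwards [(ae_restrict_iff' measurableSet_Icc).1 (hv j k hjk)] with τ hτ _ using hτ
    · simp [hjk]
  have hVall : ∀ᵐ τ : ℝ, ∀ k, τ ∈ Icc t (s k) → ‖v k τ‖ ≤ V :=
    ae_all_iff.2 fun k => (ae_restrict_iff' measurableSet_Icc).1 (hV k)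
  have hlim : ∀ τ : ℝ, (∀ j k, j ≤ k → τ ∈ Icc t (s j) → v j τ = v k τ) →
      ∀ j, τ ∈ Icc t (s j) → Tendsto (fun k => F k τ) atTop (𝓝 (v j τ)) := by
    intro τ hτ j hj
    refine tendsto_const_nhds.congr' ?_
    filter_upwards [eventually_ge_atTop j] with k hk
    have : τ ∈ Icc t (s k) := Icc_subset_Icc_right (hmono hk) hj
    simp [F, this, hτ j k hk hj]
  have hlim0 : ∀ τ : ℝ, (¬ ∃ j, τ ∈ Icc t (s j)) → Tendsto (fun k => F k τ) atTop (𝓝 0) := by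
    intro τ hτ
    refine tendsto_const_nhds.congr fun k => ?_
    have : τ ∉ Icc t (s k) := fun h => hτ ⟨k, h⟩
    simp [F, indicator_of_notMem this]
  obtain ⟨w, hwm, hw⟩ := exists_stronglyMeasurable_limit_of_tendsto_ae hFm (by
    filter_upwards [ae_restrict_of_ae hall] with τ hτ
    by_cases h : ∃ j, τ ∈ Icc t (s j)
    · obtain ⟨j, hj⟩ := h
      exact ⟨_, hlim τ hτ j hj⟩
    · exact ⟨0, hlim0 τ h⟩)
  have hweq : ∀ᵐ τ ∂(volume.restrict (Icc t r)), ∀ k, τ ∈ Icc t (s k) → v k τ = w τ := by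
    filter_upwards [ae_restrict_of_ae hall, hw] with τ hτ hwτ k hk
    exact tendsto_nhds_unique (hlim τ hτ k hk) hwτ
  have hwL : MemLp w 2 (volume.restrict (Icc t r)) := by
    refine MemLp.of_bound hwm.aestronglyMeasurable (max V 0) ?_
    filter_upwards [hweq, hw, ae_restrict_of_ae hVall] with τ h1 h2 h3
    by_cases h : ∃ j, τ ∈ Icc t (s j)
    · obtain ⟨j, hj⟩ := h
      rw [← h1 j hj]
      exact (h3 j hj).trans (le_max_left _ _)
    · rw [tendsto_nhds_unique h2 (hlim0 τ h)]
      simp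
  refine ⟨hwL.toLp w, fun k => ?_⟩
  filter_upwards [ae_restrict_of_ae_restrict_of_subset (hsub k) hweq,
    ae_restrict_of_ae_restrict_of_subset (hsub k) hwL.coeFn_toLp,
    ae_restrict_mem measurableSet_Icc] with τ h1 h2 h3
  rw [h2, h1 k h3]

/-- Feedback against a nonanticipating strategy: some disturbance stays within `ε` of a given
continuous function of the control with which the strategy answers it. -/
theorem Data.IsStrategy.exists_near_feedback {D : Data n m d} {t r G ε : ℝ}
    {α : L2 d t r → ℝ → E m} (hα : D.IsStrategy t r α) (htr : t ≤ r) (hε : 0 < ε)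
    {g : E m → E d} (hg : ContinuousOn g D.U) (hG : ∀ u ∈ D.U, ‖g u‖ ≤ G) :
    ∃ v : L2 d t r, ∀ᵐ τ ∂(volume.restrict (Icc t r)), ‖v τ - g (α v τ)‖ ≤ ε := by
  -- Zorn's lemma on partial solutions: `q.1` is the time up to which `q.2` is a near feedback, and
  -- the order is extension.
  let Q := {q : ℝ × L2 d t r // q.1 ∈ Icc t r ∧
    ∀ᵐ τ ∂(volume.restrict (Icc t q.1)), ‖q.2 τ - g (α q.2 τ)‖ ≤ ε}
  let R : Q → Q → Prop := fun a b => a.1.1 ≤ b.1.1 ∧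
    ∀ᵐ τ ∂(volume.restrict (Icc t a.1.1)), a.1.2 τ = b.1.2 τ
  have hrefl : ∀ a, R a a := fun a => ⟨le_rfl, by simp⟩
  have htrans : ∀ {a b c : Q}, R a b → R b c → R a c := by
    intro a b c hab hbc
    refine ⟨hab.1.trans hbc.1, ?_⟩
    filter_upwards [hab.2, ae_restrict_of_ae_restrict_of_subset
      (Icc_subset_Icc_right hab.1) hbc.2] with τ h1 h2
    rw [h1, h2]
  have hbound : ∀ a : Q, ∀ᵐ τ ∂(volume.restrict (Icc t a.1.1)), ‖a.1.2 τ‖ ≤ G + ε := by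
    intro a
    filter_upwards [a.2.2, ae_restrict_mem measurableSet_Icc] with τ h1 h2
    have h3 := hG _ (hα.mem_U a.1.2 τ ⟨h2.1, h2.2.trans a.2.1.2⟩)
    linarith [norm_le_norm_add_norm_sub' (a.1.2 τ) (g (α a.1.2 τ))]
  have hstart : ∀ᵐ τ ∂(volume.restrict (Icc t t)),
      ‖(0 : L2 d t r) τ - g (α (0 : L2 d t r) τ)‖ ≤ ε := by
    simp
  have hchain : ∀ c : Set Q, IsChain R c → ∃ ub, ∀ a ∈ c, R a ub := by
    intro c hc
    rcases c.eq_empty_or_nonempty with rfl | hne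
    · exact ⟨⟨(t, 0), ⟨le_rfl, htr⟩, hstart⟩, by simp⟩
    have hbdd : BddAbove ((fun a : Q => a.1.1) '' c) :=
      ⟨r, by rintro _ ⟨a, -, rfl⟩; exact a.2.1.2⟩
    obtain ⟨s, hmono, hlim, hmem⟩ := exists_seq_tendsto_sSup (hne.image _) hbdd
    choose q hqc hqs using hmem
    have hle : ∀ a ∈ c, a.1.1 ≤ sSup ((fun a : Q => a.1.1) '' c) := fun a ha =>
      le_csSup hbdd ⟨a, ha, rfl⟩
    set S := sSup ((fun a : Q => a.1.1) '' c) with hS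
    have hagree : ∀ a ∈ c, ∀ b ∈ c, ∀ᵐ τ : ℝ, τ ∈ Icc t a.1.1 → τ ∈ Icc t b.1.1 →
        a.1.2 τ = b.1.2 τ := by
      intro a ha b hb
      have : R a b ∨ R b a := by
        by_cases hab : a = b
        · exact Or.inl (hab ▸ hrefl a)
        · exact hc ha hb hab
      rcases this with h | h
      · filter_upwards [(ae_restrict_iff' measurableSet_Icc).1 h.2] with τ h1 h2 _ using h1 h2
      · filter_upwards [(ae_restrict_iff' measurableSet_Icc).1 h.2] with τ h1 _ h2
          using (h1 h2).symm
    have hsq : ∀ k, s k = (q k).1.1 := fun k => (hqs k).symm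
    obtain ⟨w, hw⟩ := exists_common_extension (V := G + ε) s
      (fun k => by rw [hsq]; exact (q k).2.1) hmono (fun k => (q k).1.2)
      (fun k => by rw [hsq]; exact hbound (q k))
      (fun j k hjk => by
        rw [ae_restrict_iff' measurableSet_Icc]
        filter_upwards [hagree _ (hqc j) _ (hqc k)] with τ h1 h2
        refine h1 (hsq j ▸ h2) ?_
        rw [← hsq k]
        exact Icc_subset_Icc_right (hmono hjk) h2)
    have hwall : ∀ᵐ τ : ℝ, ∀ k, τ ∈ Icc t (s k) → (q k).1.2 τ = w τ :=
      ae_all_iff.2 fun k => (ae_restrict_iff' measurableSet_Icc).1 (hw k)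
    -- The supremum `S` need not be attained in the chain, so the endpoint `S` is left out as a null
    -- set.
    have hcover : ∀ τ, τ < S → ∃ k, τ < s k := fun τ hτ =>
      (hlim.eventually (eventually_gt_nhds hτ)).exists
    have hneS : ∀ᵐ τ : ℝ, τ ≠ S := by simp [ae_iff]
    have hSmem : S ∈ Icc t r := by
      have ⟨a, ha⟩ := hne
      refine ⟨a.2.1.1.trans (hle a ha), csSup_le (hne.image _) ?_⟩
      rintro _ ⟨b, -, rfl⟩
      exact b.2.1.2
    have hprop : ∀ᵐ τ ∂(volume.restrict (Icc t S)), ‖w τ - g (α w τ)‖ ≤ ε := by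
      have hP : ∀ᵐ τ : ℝ, ∀ k, τ ∈ Icc t (s k) →
          ‖(q k).1.2 τ - g (α (q k).1.2 τ)‖ ≤ ε :=
        ae_all_iff.2 fun k => by
          rw [hsq]; exact (ae_restrict_iff' measurableSet_Icc).1 (q k).2.2
      rw [ae_restrict_iff' measurableSet_Icc]
      filter_upwards [hwall, hP, hneS] with τ h1 h2 h3 h4
      obtain ⟨k, hk⟩ := hcover τ (lt_of_le_of_ne h4.2 h3)
      have hτ : τ ∈ Icc t (s k) := ⟨h4.1, hk.le⟩
      have hαeq := hα.nonanticipating (q k).1.2 w (s k) (by rw [hsq]; exact (q k).2.1) (hw k) τ hτ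
      rw [← h1 k hτ, ← hαeq]
      exact h2 k hτ
    refine ⟨⟨(S, w), hSmem, hprop⟩, fun a ha => ⟨hle a ha, ?_⟩⟩
    have hag : ∀ᵐ τ : ℝ, ∀ k, τ ∈ Icc t a.1.1 → τ ∈ Icc t (q k).1.1 → a.1.2 τ = (q k).1.2 τ :=
      ae_all_iff.2 fun k => hagree a ha _ (hqc k)
    rw [ae_restrict_iff' measurableSet_Icc]
    filter_upwards [hag, hwall, hneS] with τ h1 h2 h3 h4
    obtain ⟨k, hk⟩ := hcover τ (lt_of_le_of_ne (h4.2.trans (hle a ha)) h3)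
    have hτ : τ ∈ Icc t (s k) := ⟨h4.1, hk.le⟩
    rw [h1 k h4 (hsq k ▸ hτ), h2 k hτ]
  obtain ⟨⟨⟨s, v⟩, hs, hP⟩, hmax⟩ := exists_maximal_of_chains_bounded hchain htrans
  rcases hs.2.eq_or_lt with hsr | hsr
  · simp only at hsr
    subst hsr
    exact ⟨v, hP⟩
  exfalso
  simp only at hs hP hsr
  -- If the maximal time `s` were below `r`, the disturbance could be continued by the feedback
  -- value at `s`. Nonanticipation fixes the control on `[t,s]`, endpoint included, and
  -- right-continuity keeps `g (α w τ)` within `ε` of that value just after `s`, contradicting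
  -- maximality.
  let w₀ : ℝ → E d := (Icc t s).piecewise (v : ℝ → E d) (fun _ => g (α v s))
  have hw₀ : MemLp w₀ 2 (volume.restrict (Icc t r)) :=
    MemLp.piecewise measurableSet_Icc ((Lp.memLp v).restrict _) (memLp_const _)
  let w : L2 d t r := hw₀.toLp w₀
  have hww₀ : ∀ᵐ τ ∂(volume.restrict (Icc t r)), w τ = w₀ τ := hw₀.coeFn_toLp
  have hvw : ∀ᵐ τ ∂(volume.restrict (Icc t s)), v τ = w τ := by
    filter_upwards [ae_restrict_of_ae_restrict_of_subset (Icc_subset_Icc_right hs.2) hww₀,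
      ae_restrict_mem measurableSet_Icc] with τ h1 h2
    rw [h1, show w₀ τ = v τ from piecewise_eq_of_mem _ _ _ h2]
  have hαeq := hα.nonanticipating v w s hs hvw
  have hcont : ContinuousWithinAt (fun τ => g (α w τ)) (Icc s r) s :=
    (hg _ (hα.mem_U w s hs)).comp (hα.right_continuous w s hs)
      fun τ hτ => hα.mem_U w τ ⟨hs.1.trans hτ.1, hτ.2⟩
  have hev : ∀ᶠ τ in 𝓝[Icc s r] s, ‖g (α v s) - g (α w τ)‖ < ε := by
    have := hcont.tendsto.eventually (Metric.ball_mem_nhds _ hε)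
    filter_upwards [this] with τ hτ
    rw [hαeq s ⟨hs.1, le_rfl⟩, ← dist_eq_norm, dist_comm]
    exact hτ
  rw [nhdsWithin_Icc_eq_nhdsGE hsr] at hev
  obtain ⟨s', hs', hsub⟩ := (mem_nhdsGE_iff_exists_Icc_subset).1 hev
  have hs'' : s < min s' r := lt_min hs' hsr
  have hw : ∀ᵐ τ ∂(volume.restrict (Icc t (min s' r))), ‖w τ - g (α w τ)‖ ≤ ε := by
    rw [ae_restrict_iff' measurableSet_Icc] at hP hww₀ hvw ⊢
    filter_upwards [hP, hww₀, hvw] with τ h1 h2 h3 h4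
    rcases le_or_gt τ s with h | h
    · have hτ : τ ∈ Icc t s := ⟨h4.1, h⟩
      rw [← h3 hτ, ← hαeq τ hτ]
      exact h1 hτ
    · have hτ : τ ∉ Icc t s := fun h' => absurd h'.2 (not_le.2 h)
      rw [h2 ⟨h4.1, h4.2.trans (min_le_right _ _)⟩,
        show w₀ τ = g (α v s) from piecewise_eq_of_notMem _ _ _ hτ]
      exact (hsub ⟨h.le, h4.2.trans (min_le_left _ _)⟩ : ‖_‖ < ε).le
  have := hmax ⟨(min s' r, w), ⟨hs.1.trans hs''.le, min_le_right _ _⟩, hw⟩ ⟨hs''.le, hvw⟩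
  exact absurd this.1 (not_le.2 hs'')

/-! ### The Hamiltonian and its envelopes -/

section Hamiltonian

variable (D : Data n m d) (x p : E n) (u : E m)

/-- Completing the square: the maximizer is `σᵀp`, and a disturbance at distance `ε` from it loses
only `½ε²`. -/
theorem Data.inner_velocity_sub_energy (v : E d) :
    inner ℝ (D.f x u + D.σ x u v) p - 1 / 2 * ‖v‖ ^ 2 =
      inner ℝ (D.f x u) p + 1 / 2 * ‖(D.σ x u).adjoint p‖ ^ 2
        - 1 / 2 * ‖v - (D.σ x u).adjoint p‖ ^ 2 := by
  rw [inner_add_left, norm_sub_sq_real, ContinuousLinearMap.adjoint_inner_right]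
  ring

theorem Data.lt_of_lt_Hu {c : ℝ} (h : (c : EReal) < D.Hu u x p) :
    c < inner ℝ (D.f x u) p + 1 / 2 * ‖(D.σ x u).adjoint p‖ ^ 2 := by
  obtain ⟨v, hv⟩ := lt_iSup_iff.1 h
  rw [EReal.coe_lt_coe_iff, D.inner_velocity_sub_energy] at hv
  nlinarith [sq_nonneg ‖v - (D.σ x u).adjoint p‖]

theorem Data.le_of_Hu_lt {c : ℝ} (h : D.Hu u x p < (c : EReal)) (v : E d) :
    inner ℝ (D.f x u + D.σ x u v) p - 1 / 2 * ‖v‖ ^ 2 ≤ c :=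
  EReal.coe_le_coe_iff.1 ((le_iSup (fun v : E d =>
    ((inner ℝ (D.f x u + D.σ x u v) p - 1 / 2 * ‖v‖ ^ 2 : ℝ) : EReal)) v).trans h.le)

/-- Only the level `r` is perturbed, upwards, which enlarges the admissible set of controls. -/
theorem Data.exists_of_lt_lowerEnvelope {r c : ℝ}
    (h : (c : EReal) < lowerEnvelope D.H (x, r, p)) :
    ∃ ρ > 0, ∀ u ∈ D.U, D.l x u ≤ r + ρ →
      c < inner ℝ (D.f x u) p + 1 / 2 * ‖(D.σ x u).adjoint p‖ ^ 2 := by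
  have h1 := eventually_lt_of_lt_liminf h
  have h2 : Tendsto (fun s : ℝ => (x, s, p)) (𝓝 r) (𝓝 (x, r, p)) :=
    Continuous.tendsto (by fun_prop) r
  obtain ⟨ρ, hρ, hball⟩ := Metric.eventually_nhds_iff.1 (h2.eventually h1)
  refine ⟨ρ / 2, half_pos hρ, fun u hu hl => D.lt_of_lt_Hu x p u ?_⟩
  have h3 := hball (y := r + ρ / 2) (by rw [Real.dist_eq]; simp [abs_of_pos (half_pos hρ), hρ])
  exact h3.trans_le (iInf₂_le u ⟨hu, hl⟩)

/-- Lowering the level gives a control with strict slack in the constraint. The admissible set there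
is nonempty because an empty infimum would be `⊤`. -/
theorem Data.exists_of_upperEnvelope_lt {r c : ℝ}
    (h : upperEnvelope D.H (x, r, p) < (c : EReal)) :
    ∃ ρ > 0, ∃ u ∈ D.U, D.l x u ≤ r - ρ ∧
      ∀ v : E d, inner ℝ (D.f x u + D.σ x u v) p - 1 / 2 * ‖v‖ ^ 2 ≤ c := by
  have h1 := eventually_lt_of_limsup_lt h
  have h2 : Tendsto (fun s : ℝ => (x, s, p)) (𝓝 r) (𝓝 (x, r, p)) :=
    Continuous.tendsto (by fun_prop) r
  obtain ⟨ρ, hρ, hball⟩ := Metric.eventually_nhds_iff.1 (h2.eventually h1)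
  have h3 := hball (y := r - ρ / 2) (by rw [Real.dist_eq]; simp [abs_of_pos (half_pos hρ), hρ])
  obtain ⟨u, hu⟩ := iInf_lt_iff.1 h3
  obtain ⟨hA, hu⟩ := iInf_lt_iff.1 hu
  exact ⟨ρ / 2, half_pos hρ, u, hA.1, hA.2, D.le_of_Hu_lt x p u hu⟩

end Hamiltonian

/-! ### Expansion and growth of the test function -/

section TestFunction

variable {T : ℝ} {φ : ℝ → E n → ℝ} {t : ℝ} {x : E n}

theorem IsC1b.first_order (hφ : IsC1b T φ) (ht : t ∈ Ioo 0 T) (x : E n) {η : ℝ} (hη : 0 < η) :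
    ∃ ρ > 0, ∀ h y, 0 ≤ h → h < ρ → ‖y - x‖ < ρ →
      |φ (t + h) y - φ t x - (h * deriv (fun s => φ s x) t + inner ℝ (y - x) (∇ (φ t) x))|
        ≤ η * (h + ‖y - x‖) := by
  have hopen : Ioo 0 T ×ˢ (univ : Set (E n)) ∈ 𝓝 (t, x) :=
    (isOpen_Ioo.prod isOpen_univ).mem_nhds ⟨ht, mem_univ _⟩
  have hd : HasFDerivAt (Function.uncurry φ) (fderiv ℝ (Function.uncurry φ) (t, x)) (t, x) :=
    ((hφ.contDiffOn.contDiffAt hopen).differentiableAt (by simp)).hasFDerivAt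
  set A := fderiv ℝ (Function.uncurry φ) (t, x) with hA
  have h1 : HasFDerivAt (fun s => φ s x) (A.comp (ContinuousLinearMap.inl ℝ ℝ (E n))) t :=
    HasFDerivAt.comp (g := Function.uncurry φ) (f := fun s => (s, x)) t hd
      (hasFDerivAt_prodMk_left t x)
  have h2 : HasFDerivAt (φ t) (A.comp (ContinuousLinearMap.inr ℝ ℝ (E n))) x :=
    HasFDerivAt.comp (g := Function.uncurry φ) (f := fun y => (t, y)) x hd
      (hasFDerivAt_prodMk_right t x)
  have e1 : deriv (fun s => φ s x) t = A (1, 0) := by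
    rw [h1.hasDerivAt.deriv]; simp
  have e2 : ∀ k : E n, inner ℝ k (∇ (φ t) x) = A (0, k) := by
    intro k
    rw [h2.hasGradientAt.gradient, real_inner_comm, InnerProductSpace.toDual_symm_apply]
    simp
  have hlin : ∀ (h : ℝ) (k : E n), A (h, k) = h * A (1, 0) + A (0, k) := by
    intro h k
    have : ((h, k) : ℝ × E n) = h • (1, 0) + (0, k) := by simp
    rw [this, map_add, map_smul, smul_eq_mul]
  have h3 := (hasFDerivAt_iff_isLittleO_nhds_zero.1 hd).def hη
  obtain ⟨ρ, hρ, hball⟩ := Metric.eventually_nhds_iff.1 h3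
  refine ⟨ρ, hρ, fun h y h0 hh hy => ?_⟩
  have h4 := hball (y := (h, y - x)) (by
    rw [dist_zero_right, Prod.norm_def, max_lt_iff, Real.norm_of_nonneg h0]
    exact ⟨hh, hy⟩)
  rw [e1, e2, ← hlin]
  have e : ((t, x) : ℝ × E n) + (h, y - x) = (t + h, y) := by simp
  rw [e, Real.norm_eq_abs] at h4
  refine h4.trans (mul_le_mul_of_nonneg_left ?_ hη.le)
  rw [Prod.norm_def, Real.norm_of_nonneg h0]
  exact max_le (by linarith [norm_nonneg (y - x)]) (by linarith)

/-- Needed for disturbances of large energy, which may carry the state far away. Near `x` it follows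
from the first-order expansion; at distance at least `ρ` the total variation `2C` of `φ` is at most
`(2C/ρ)‖y - x‖`. -/
theorem IsC1b.linear_growth (hφ : IsC1b T φ) (ht : t ∈ Ioo 0 T) (x : E n) :
    ∃ L ≥ 0, ∃ ρ > 0, ∀ h y, 0 ≤ h → h < ρ → φ (t + h) y ≤ φ t x + L * (h + ‖y - x‖) := by
  obtain ⟨ρ, hρ, H⟩ := hφ.first_order ht x one_pos
  obtain ⟨C, hC⟩ := hφ.bdd
  set q := deriv (fun s => φ s x) t
  set p := ∇ (φ t) x
  have hC0 : 0 ≤ C := (abs_nonneg _).trans (hC t ht x)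
  refine ⟨|q| + ‖p‖ + 1 + 2 * C / ρ, by positivity, min ρ (T - t),
    lt_min hρ (sub_pos.2 ht.2), fun h y h0 hh => ?_⟩
  have hk := norm_nonneg (y - x)
  rcases lt_or_ge ‖y - x‖ ρ with hy | hy
  · have h1 := (abs_le.1 (H h y h0 (hh.trans_le (min_le_left _ _)) hy)).2
    have h2 : h * q ≤ |q| * (h + ‖y - x‖) := by
      nlinarith [le_abs_self q, abs_nonneg q]
    have h3 : inner ℝ (y - x) p ≤ ‖p‖ * (h + ‖y - x‖) := by
      nlinarith [real_inner_le_norm (y - x) p, norm_nonneg p]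
    have h4 : 0 ≤ 2 * C / ρ * (h + ‖y - x‖) := by positivity
    linarith
  · have h1 := (abs_le.1 (hC (t + h) ⟨by linarith [ht.1], by
      linarith [hh.trans_le (min_le_right ρ (T - t))]⟩ y)).2
    have h2 := (abs_le.1 (hC t ht x)).1
    have h3 : 2 * C ≤ 2 * C / ρ * (h + ‖y - x‖) := by
      rw [div_mul_eq_mul_div, le_div_iff₀ hρ]
      nlinarith
    have h4 : 0 ≤ (|q| + ‖p‖ + 1) * (h + ‖y - x‖) := by positivity
    linarith

end TestFunction

theorem eventually_mul_lt (C : ℝ) {κ : ℝ} (hκ : 0 < κ) : ∀ᶠ δ in 𝓝[>] (0 : ℝ), δ * C < κ := by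
  have : Tendsto (fun δ : ℝ => δ * C) (𝓝 0) (𝓝 (0 * C)) := tendsto_id.mul_const C
  rw [zero_mul] at this
  exact (this.eventually (gt_mem_nhds hκ)).filter_mono nhdsWithin_le_nhds

/-- Young's inequality, from `(a - ‖v‖)² ≥ 0`. The free parameter `a` lets the energy absorb any
multiple of the `L¹` norm at a cost of order `r - t`. -/
theorem integral_norm_le_of_memLp_two {V : Type*} [NormedAddCommGroup V] {t r : ℝ} {v : ℝ → V}
    (hv : MemLp v 2 (volume.restrict (Icc t r))) (htr : t ≤ r) (a : ℝ) :
    2 * a * ∫ s in Icc t r, ‖v s‖ ≤ a ^ 2 * (r - t) + ∫ s in Icc t r, ‖v s‖ ^ 2 := by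
  have h1 : IntegrableOn (fun s => ‖v s‖) (Icc t r) := (hv.integrable (by norm_num)).norm
  have h2 : IntegrableOn (fun s => ‖v s‖ ^ 2) (Icc t r) :=
    (memLp_two_iff_integrable_sq_norm hv.1).1 hv
  have h3 : ∫ s in Icc t r, 2 * a * ‖v s‖ ≤ ∫ s in Icc t r, (a ^ 2 + ‖v s‖ ^ 2) := by
    refine integral_mono (h1.const_mul _) ((integrable_const _).add h2) fun s => ?_
    nlinarith [sq_nonneg (a - ‖v s‖)]
  rw [integral_const_mul, integral_add (integrable_const _) h2] at h3
  simpa [htr, mul_comm] using h3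

/-! ### Reduction of the value and the quotient to real inequalities -/

section Expectation

variable {D : Data n m d} {t r : ℝ}

theorem Data.isStrategy_const {u : E m} (hu : u ∈ D.U) :
    D.IsStrategy t r (fun _ _ => u) where
  mem_U _ _ _ := hu
  memLp_top _ := memLp_const u
  right_continuous _ _ _ := continuousWithinAt_const
  left_limits _ _ _ := ⟨u, tendsto_const_nhds⟩
  nonanticipating _ _ _ _ _ _ _ := rfl

theorem Data.F_le_of_const {φ : E n → ℝ} {x : E n} {u : E m} {B : ℝ} (htr : t < r)
    (hu : u ∈ D.U)
    (h : ∀ (v : L2 d t r) (X : ℝ → E n), D.IsTrajectory t r x (fun _ => u) v X →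
      (∀ s ∈ Icc t r, D.l (X s) u - 1 / 2 * ∫ s in Icc t r, ‖v s‖ ^ 2 ≤ B) ∧
        φ (X r) - 1 / 2 * ∫ s in Icc t r, ‖v s‖ ^ 2 ≤ B) :
    D.F t r (fun y => (φ y : EReal)) x ≤ B := by
  rw [Data.F, if_neg htr.ne]
  refine (iInf₂_le (fun _ _ => u) (D.isStrategy_const hu)).trans (iSup_le fun v => ?_)
  have hv := h v
  set W := 1 / 2 * ∫ s in Icc t r, ‖v s‖ ^ 2
  have hcost : D.cost t r (fun y => (φ y : EReal)) x (fun _ _ => u) v ≤ ((B + W : ℝ) : EReal) := by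
    refine iSup₂_le fun X hX => max_le (essSup_le_of_ae_le _ ?_) ?_
    · filter_upwards [ae_restrict_mem measurableSet_Icc] with s hs
      exact EReal.coe_le_coe_iff.2 (by linarith [(hv X hX).1 s hs])
    · exact EReal.coe_le_coe_iff.2 (by linarith [(hv X hX).2])
  refine (add_le_add_left hcost _).trans ?_
  rw [← EReal.coe_add]
  exact EReal.coe_le_coe_iff.2 (by linarith)

theorem Data.le_maxPlusExp {φ : E n → ℝ} {x : E n} {α : L2 d t r → ℝ → E m} {v : L2 d t r}
    {X : ℝ → E n} (hX : D.IsTrajectory t r x (α v) v X) {B z : ℝ}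
    (hz : (z : EReal) ≤ max (essSup (fun s => (D.l (X s) (α v s) : EReal))
      (volume.restrict (Icc t r))) (φ (X r) : EReal))
    (hB : B ≤ z - 1 / 2 * ∫ s in Icc t r, ‖v s‖ ^ 2) :
    (B : EReal) ≤ maxPlusExp t r (D.cost t r (fun y => (φ y : EReal)) x α) := by
  refine le_trans ?_ (le_iSup (fun v : L2 d t r => D.cost t r (fun y => (φ y : EReal)) x α v +
    ((-(1 / 2 * ∫ s in Icc t r, ‖v s‖ ^ 2) : ℝ) : EReal)) v)
  have h1 : (z : EReal) ≤ D.cost t r (fun y => (φ y : EReal)) x α v :=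
    hz.trans (le_iSup₂ (f := fun (X : ℝ → E n) (_ : D.IsTrajectory t r x (α v) v X) =>
      max (essSup (fun s => (D.l (X s) (α v s) : EReal)) (volume.restrict (Icc t r)))
        (φ (X r) : EReal)) X hX)
  refine le_trans ?_ (add_le_add_left h1 _)
  rw [← EReal.coe_add]
  exact EReal.coe_le_coe_iff.2 (by linarith)

theorem Data.quotient_le {φ : ℝ → E n → ℝ} {x : E n} {δ a : ℝ} (hδ : 0 < δ)
    (h : D.F t (t + δ) (fun y => (φ (t + δ) y : EReal)) x ≤ ((φ t x + δ * a : ℝ) : EReal)) :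
    D.quotient φ t x δ ≤ a := by
  have h1 := EReal.sub_le_sub h (le_refl (φ t x : EReal))
  have h2 : (0 : EReal) ≤ ((δ⁻¹ : ℝ) : EReal) := EReal.coe_nonneg.2 (inv_nonneg.2 hδ.le)
  refine (mul_le_mul_of_nonneg_left h1 h2).trans ?_
  rw [← EReal.coe_sub, ← EReal.coe_mul]
  refine EReal.coe_le_coe_iff.2 (le_of_eq ?_)
  field_simp
  ring

theorem Data.le_quotient {φ : ℝ → E n → ℝ} {x : E n} {δ a : ℝ} (hδ : 0 < δ)
    (h : ((φ t x + δ * a : ℝ) : EReal) ≤ D.F t (t + δ) (fun y => (φ (t + δ) y : EReal)) x) :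
    (a : EReal) ≤ D.quotient φ t x δ := by
  have h1 := EReal.sub_le_sub h (le_refl (φ t x : EReal))
  have h2 : (0 : EReal) ≤ ((δ⁻¹ : ℝ) : EReal) := EReal.coe_nonneg.2 (inv_nonneg.2 hδ.le)
  refine le_trans ?_ (mul_le_mul_of_nonneg_left h1 h2)
  rw [← EReal.coe_sub, ← EReal.coe_mul]
  refine EReal.coe_le_coe_iff.2 (le_of_eq ?_)
  field_simp
  ring

end Expectation

/-! ### The two one-sided estimates and the conclusion -/

variable {D : Data n m d} {M T t : ℝ} {φ : ℝ → E n → ℝ}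

theorem Data.eventually_F_le (hM : D.BoundedBy M) (hφ : IsC1b T φ) (ht : t ∈ Ioo 0 T) (x : E n)
    {c e : ℝ} (hc : upperEnvelope D.H (x, φ t x, ∇ (φ t) x) < c) (he : 0 < e) :
    ∀ᶠ δ in 𝓝[>] (0 : ℝ), D.F t (t + δ) (fun y => (φ (t + δ) y : EReal)) x ≤
      ((φ t x + δ * (deriv (fun s => φ s x) t + c + e) : ℝ) : EReal) := by
  obtain ⟨ρ, hρ, u, hu, hl, hc⟩ := D.exists_of_upperEnvelope_lt x _ hc
  set p := ∇ (φ t) x with hp_def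
  set q := deriv (fun s => φ s x) t with hq_def
  obtain ⟨L, hL, ρ₁, hρ₁, hgrow⟩ := hφ.linear_growth ht x
  have hMpos := hM.pos
  have hp := norm_nonneg p
  set C := L + L * M + L ^ 2 * M ^ 2 with hC
  have hC0 : 0 ≤ C := by positivity
  -- Energy threshold: Young's inequality with `a = 2LM` costs a quarter of the energy `W`. The
  -- remaining `W/4` must cover `(C + |q + c + e|) δ`.
  set R := 4 * (C + |q + c + e|) with hR
  have hR0 : 0 ≤ R := by positivity
  -- Below the threshold, Young's inequality with `a = 1` bounds `δ + ∫‖v‖` by `N₀ δ`.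
  set N₀ := 1 + 1 / 2 * (1 + R) with hN₀
  have hN₀0 : 0 < N₀ := by positivity
  set η := e / (2 * (1 + M * N₀)) with hη
  have hη0 : 0 < η := by positivity
  obtain ⟨ρ₂, hρ₂, hfirst⟩ := hφ.first_order ht x hη0
  filter_upwards [self_mem_nhdsWithin, eventually_mul_lt 1 hρ₁, eventually_mul_lt 1 hρ₂,
    eventually_mul_lt (M * N₀) hρ₂, eventually_mul_lt (M ^ 2 + 1 / 2 * M ^ 4 - (q + c + e)) hρ,
    eventually_mul_lt (M * (M * N₀) * ‖p‖ * N₀) (half_pos he)] with δ hδ h1 h2 h3 h4 h5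
  have hδ : 0 < δ := hδ
  rw [mul_one] at h1 h2
  refine D.F_le_of_const (by linarith) hu fun v X hX => ?_
  have hle : t ≤ t + δ := by linarith
  have hv := Lp.memLp v
  have hv1 : IntegrableOn (fun s => ‖v s‖) (Icc t (t + δ)) := (hv.integrable (by norm_num)).norm
  have hv2 : IntegrableOn (fun s => ‖v s‖ ^ 2) (Icc t (t + δ)) :=
    (memLp_two_iff_integrable_sq_norm hv.1).1 hv
  have hdisp : ∀ s ∈ Icc t (t + δ), ‖X s - x‖ ≤ M * (δ + ∫ τ in Icc t (t + δ), ‖v τ‖) := by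
    intro s hs
    simpa using hX.norm_sub_le hM (fun _ _ => hu) hv1 hs
  have hyoung : ∀ a : ℝ, 2 * a * ∫ s in Icc t (t + δ), ‖v s‖ ≤
      a ^ 2 * δ + ∫ s in Icc t (t + δ), ‖v s‖ ^ 2 := fun a => by
    simpa using integral_norm_le_of_memLp_two hv hle a
  have henergy := hX.inner_sub_energy hle hv2 p
  have hinner := hX.integrable_inner_sub_energy hv2 p
  have hN0 : 0 ≤ ∫ s in Icc t (t + δ), ‖v s‖ := integral_nonneg fun _ => norm_nonneg _
  have hX' := hdisp (t + δ) ⟨hle, le_rfl⟩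
  set N := ∫ s in Icc t (t + δ), ‖v s‖ with hN
  set W := ∫ s in Icc t (t + δ), ‖v s‖ ^ 2
  constructor
  -- Running cost: the slack `ρ` in `l(x,u)` dominates, since Young's inequality with `a = M²`
  -- absorbs the displacement caused by `v` into the energy.
  · intro s hs
    have k1 := (abs_le.1 (hM.l_lip u hu (X s) x)).2
    have k2 := mul_le_mul_of_nonneg_left (hdisp s hs) hMpos.le
    have k3 := hyoung (M ^ 2)
    nlinarith
  rcases le_or_gt (R * δ) W with hlarge | hsmall
  · have k1 := hgrow δ (X (t + δ)) hδ.le h1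
    have k2 := mul_le_mul_of_nonneg_left hX' hL
    have k3 := hyoung (2 * L * M)
    have k4 := mul_le_mul_of_nonneg_right (neg_abs_le (q + c + e)) hδ.le
    have k5 : R * δ = 4 * (C * δ) + 4 * (|q + c + e| * δ) := by rw [hR]; ring
    have k6 : C * δ = L * δ + L * M * δ + L ^ 2 * M ^ 2 * δ := by rw [hC]; ring
    linarith
  · have k1 : δ + N ≤ N₀ * δ := by
      have := hyoung 1
      rw [hN₀]
      linarith
    have k2 : ∀ s ∈ Icc t (t + δ), ‖X s - x‖ ≤ M * N₀ * δ := fun s hs =>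
      (hdisp s hs).trans (by rw [mul_assoc]; exact mul_le_mul_of_nonneg_left k1 hMpos.le)
    have k3 := k2 (t + δ) ⟨hle, le_rfl⟩
    have k4 := (abs_le.1 (hfirst δ (X (t + δ)) hδ.le h2 (by linarith))).2
    rw [← hp_def, ← hq_def] at k4
    have hone : Integrable (fun _ : ℝ => (1 : ℝ)) (volume.restrict (Icc t (t + δ))) :=
      integrable_const _
    have hsum : Integrable (fun s => M * (M * N₀ * δ) * ‖p‖ * (1 + ‖v s‖))
        (volume.restrict (Icc t (t + δ))) := (hone.add hv1).const_mul _
    -- Coefficients are frozen at `x`. The error integrates to `O(δ²)` and takes `e/2` of the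
    -- margin; the expansion error `η` takes the other half.
    have hbound : ∫ s in Icc t (t + δ),
        (inner ℝ (D.velocity X (fun _ => u) v s) p - 1 / 2 * ‖v s‖ ^ 2) ≤
        ∫ s in Icc t (t + δ), (c + M * (M * N₀ * δ) * ‖p‖ * (1 + ‖v s‖)) := by
      refine setIntegral_mono_on hinner ?_ measurableSet_Icc fun s hs => ?_
      · exact (integrable_const _).add hsum
      · have e1 : inner ℝ (D.velocity X (fun _ => u) v s) p =
            inner ℝ (D.f x u + D.σ x u (v s)) p + inner ℝ ((D.f (X s) u + D.σ (X s) u (v s)) -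
              (D.f x u + D.σ x u (v s))) p := by
          rw [← inner_add_left, add_sub_cancel]; rfl
        have e2 := real_inner_le_norm ((D.f (X s) u + D.σ (X s) u (v s)) -
              (D.f x u + D.σ x u (v s))) p
        have e3 := hM.velocity_sub_le hu (X s) x (v s)
        have e4 : M * (1 + ‖v s‖) * ‖X s - x‖ ≤ M * (1 + ‖v s‖) * (M * N₀ * δ) :=
          mul_le_mul_of_nonneg_left (k2 s hs) (by positivity)
        have e5 := mul_le_mul_of_nonneg_right (e3.trans e4) hp
        have e6 := hc (v s)
        rw [e1]
        linarith
    rw [integral_add (integrable_const _) hsum,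
      integral_const_mul, integral_add hone hv1] at hbound
    simp only [integral_const, measureReal_restrict_apply_univ, Real.volume_real_Icc,
      add_sub_cancel_left, max_eq_left hδ.le, smul_eq_mul, mul_one] at hbound
    rw [← henergy, ← hN] at hbound
    have k5 : M * (M * N₀ * δ) * ‖p‖ * (δ + N) ≤ M * (M * N₀ * δ) * ‖p‖ * (N₀ * δ) :=
      mul_le_mul_of_nonneg_left k1 (by positivity)
    have k6 := mul_le_mul_of_nonneg_left h5.le hδ.le
    have k7 : η * (δ + ‖X (t + δ) - x‖) ≤ η * (δ + M * N₀ * δ) :=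
      mul_le_mul_of_nonneg_left (by linarith) hη0.le
    have k8 : η * (δ + M * N₀ * δ) = δ * (e / 2) := by
      rw [hη]; field_simp
    linarith

theorem Data.eventually_le_F (hD : D.Standing) (hM : D.BoundedBy M) (hφ : IsC1b T φ)
    (ht : t ∈ Ioo 0 T) (x : E n) {c e : ℝ}
    (hc : (c : EReal) < lowerEnvelope D.H (x, φ t x, ∇ (φ t) x)) (he : 0 < e) :
    ∀ᶠ δ in 𝓝[>] (0 : ℝ), ((φ t x + δ * (deriv (fun s => φ s x) t + c - e) : ℝ) : EReal) ≤
      D.F t (t + δ) (fun y => (φ (t + δ) y : EReal)) x := by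
  obtain ⟨ρ, hρ, hc⟩ := D.exists_of_lt_lowerEnvelope x _ hc
  set p := ∇ (φ t) x with hp_def
  set q := deriv (fun s => φ s x) t with hq_def
  have hMpos := hM.pos
  have hp := norm_nonneg p
  set V := M * ‖p‖ + 1 with hV
  have hV0 : 0 < V := by positivity
  set B := M * (1 + V) with hB
  have hB0 : 0 < B := by positivity
  set η := e / (3 * (1 + B)) with hη
  have hη0 : 0 < η := by positivity
  -- The margin `e` is split in three: near feedback, freezing of coefficients, expansion of `φ`.
  -- With `ε ≤ 1` one has `ε² ≤ ε`, and `‖v‖` is bounded by `V`.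
  set ε := min 1 (e / 3) with hε
  have hε0 : 0 < ε := lt_min one_pos (by positivity)
  have hε1 : ε ≤ 1 := min_le_left _ _
  have hεe : ε ≤ e / 3 := min_le_right _ _
  obtain ⟨ρ₁, hρ₁, hfirst⟩ := hφ.first_order ht x hη0
  have hg : ContinuousOn (fun u => (D.σ x u).adjoint p) D.U := by
    obtain ⟨σx, σu, hσ, -⟩ := hD.σ_C1
    have h1 : ContinuousOn (fun u => D.σ x u) D.U :=
      hσ.continuousOn.comp (f := fun u => (x, u)) (by fun_prop) fun u hu => ⟨mem_univ _, hu⟩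
    exact (ContinuousLinearMap.adjoint.continuous.comp_continuousOn h1).clm_apply
      continuousOn_const
  have hG : ∀ u ∈ D.U, ‖(D.σ x u).adjoint p‖ ≤ M * ‖p‖ := fun u hu =>
    ((D.σ x u).adjoint.le_opNorm p).trans (mul_le_mul_of_nonneg_right
      (by rw [LinearIsometryEquiv.norm_map]; exact hM.σ_le x u hu) hp)
  filter_upwards [self_mem_nhdsWithin, eventually_mul_lt 1 hρ₁, eventually_mul_lt B hρ₁,
    eventually_mul_lt B one_pos, eventually_mul_lt (M * B) (half_pos hρ),
    eventually_mul_lt (q + c - e + 1 / 2 * V ^ 2) (half_pos hρ),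
    eventually_mul_lt (B * B * ‖p‖) (show 0 < e / 3 by positivity)]
    with δ hδ h1 h2 h3 h4 h5 h6
  have hδ : 0 < δ := hδ
  have hle : t ≤ t + δ := by linarith
  rw [mul_one] at h1
  rw [Data.F, if_neg (by linarith)]
  refine le_iInf₂ fun α hα => ?_
  obtain ⟨v, hvα⟩ := hα.exists_near_feedback hle hε0 hg hG
  have hv := Lp.memLp v
  have hv1 : IntegrableOn (fun s => ‖v s‖) (Icc t (t + δ)) := (hv.integrable (by norm_num)).norm
  have hv2 : IntegrableOn (fun s => ‖v s‖ ^ 2) (Icc t (t + δ)) :=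
    (memLp_two_iff_integrable_sq_norm hv.1).1 hv
  have hvV : ∀ᵐ s ∂(volume.restrict (Icc t (t + δ))), ‖v s‖ ≤ V := by
    filter_upwards [hvα, ae_restrict_mem measurableSet_Icc] with s k1 k2
    linarith [hG _ (hα.mem_U v s k2),
      norm_le_norm_add_norm_sub' (v s) ((D.σ x (α v s)).adjoint p)]
  obtain ⟨X, hX⟩ := hD.exists_trajectory hM hV0.le hle
    (by rw [← hB]; linarith) (hα.mem_U v) (hα.memLp_top v).1 hv.1 hvV x
  have hconst : ∀ a : ℝ, ∫ _ in Icc t (t + δ), a = δ * a := fun a => by simp [hδ.le]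
  have hN : ∫ s in Icc t (t + δ), ‖v s‖ ≤ δ * V := by
    rw [← hconst]
    exact integral_mono_ae hv1 (integrable_const _) hvV
  have hW : ∫ s in Icc t (t + δ), ‖v s‖ ^ 2 ≤ δ * V ^ 2 := by
    rw [← hconst]
    refine integral_mono_ae hv2 (integrable_const _) ?_
    filter_upwards [hvV] with s hs
    exact pow_le_pow_left₀ (norm_nonneg _) hs 2
  have hdisp : ∀ s ∈ Icc t (t + δ), ‖X s - x‖ ≤ δ * B := by
    intro s hs
    have k1 := hX.norm_sub_le hM (hα.mem_U v) hv1 hs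
    rw [add_sub_cancel_left] at k1
    have k2 := mul_le_mul_of_nonneg_left hN hMpos.le
    rw [hB]
    linarith
  -- If the essential supremum is large it alone suffices, since energy and target increment are
  -- `O(δ)`. Otherwise `l(X(s), α[v](s)) < φ(t,x) + ρ/2` a.e., and the displacement costs less than
  -- another `ρ/2` in replacing `X(s)` by `x`.
  rcases le_or_gt ((φ t x + ρ / 2 : ℝ) : EReal)
    (essSup (fun s => (D.l (X s) (α v s) : EReal)) (volume.restrict (Icc t (t + δ)))) with hess | hess
  · exact Data.le_maxPlusExp hX (hess.trans (le_max_left _ _)) (by linarith)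
  · refine Data.le_maxPlusExp hX (le_max_right _ _) ?_
    have hlow : ∫ s in Icc t (t + δ), (c - e / 3 - B * (δ * B) * ‖p‖) ≤
        ∫ s in Icc t (t + δ), (inner ℝ (D.velocity X (α v) v s) p - 1 / 2 * ‖v s‖ ^ 2) := by
      refine integral_mono_ae (integrable_const _) (hX.integrable_inner_sub_energy hv2 p) ?_
      filter_upwards [hvα, hvV, ae_restrict_mem measurableSet_Icc, ae_lt_of_essSup_lt hess]
        with s k1 k2 k3 k4
      rw [EReal.coe_lt_coe_iff] at k4
      have hu := hα.mem_U v s k3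
      have j0 := hdisp s k3
      have j1 := (abs_le.1 (hM.l_lip _ hu (X s) x)).1
      have j2 := mul_le_mul_of_nonneg_left j0 hMpos.le
      have j3 := hc _ hu (by linarith)
      have j4 := D.inner_velocity_sub_energy x p (α v s) (v s)
      have e1 : inner ℝ (D.velocity X (α v) v s) p =
          inner ℝ (D.f x (α v s) + D.σ x (α v s) (v s)) p -
            inner ℝ ((D.f x (α v s) + D.σ x (α v s) (v s)) -
              (D.f (X s) (α v s) + D.σ (X s) (α v s) (v s))) p := by
        rw [← inner_sub_left, sub_sub_cancel]; rfl
      have e2 := real_inner_le_norm ((D.f x (α v s) + D.σ x (α v s) (v s)) -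
              (D.f (X s) (α v s) + D.σ (X s) (α v s) (v s))) p
      have e3 := hM.velocity_sub_le hu x (X s) (v s)
      have e4 : M * (1 + ‖v s‖) * ‖x - X s‖ ≤ B * (δ * B) := by
        rw [norm_sub_rev x]
        exact mul_le_mul (mul_le_mul_of_nonneg_left (by linarith) hMpos.le) j0
          (norm_nonneg _) hB0.le
      have e5 := mul_le_mul_of_nonneg_right (e3.trans e4) hp
      have e6 : ‖v s - (D.σ x (α v s)).adjoint p‖ ^ 2 ≤ ε * 1 := by
        rw [sq]
        exact mul_le_mul k1 (k1.trans hε1) (norm_nonneg _) hε0.le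
      rw [e1]
      linarith
    rw [hconst, ← hX.inner_sub_energy hle hv2 p] at hlow
    have k3 := hdisp (t + δ) ⟨hle, le_rfl⟩
    have k4 := (abs_le.1 (hfirst δ (X (t + δ)) hδ.le h1 (by linarith))).1
    rw [← hp_def, ← hq_def] at k4
    have k6 := mul_le_mul_of_nonneg_left h6.le hδ.le
    have k7 : η * (δ + ‖X (t + δ) - x‖) ≤ η * (δ + δ * B) :=
      mul_le_mul_of_nonneg_left (by linarith) hη0.le
    have k8 : η * (δ + δ * B) = δ * (e / 3) := by
      rw [hη]; field_simp
    linarith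

end MaxPlus

theorem mainTheorem5 {n m d : ℕ} (D : MaxPlus.Data n m d) (hD : D.Standing) (T : ℝ)
    (φ : ℝ → MaxPlus.E n → ℝ) (hφ : MaxPlus.IsC1b T φ)
    (t : ℝ) (ht : t ∈ Ioo 0 T) (x : MaxPlus.E n) :
    limsup (fun δ : ℝ => D.quotient φ t x δ) (𝓝[>] 0) ≤
        ((deriv (fun s => φ s x) t : ℝ) : EReal) +
          MaxPlus.upperEnvelope D.H (x, φ t x, ∇ (φ t) x) ∧
      ((deriv (fun s => φ s x) t : ℝ) : EReal) +
          MaxPlus.lowerEnvelope D.H (x, φ t x, ∇ (φ t) x) ≤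
        liminf (fun δ : ℝ => D.quotient φ t x δ) (𝓝[>] 0) := by
  obtain ⟨M, hM⟩ := hD.exists_boundedBy
  set q := deriv (fun s => φ s x) t
  constructor
  · refine EReal.le_of_forall_lt_iff_le.1 fun z hz => ?_
    rw [add_comm] at hz
    have hz' := (EReal.lt_sub_iff_add_lt (Or.inl (EReal.coe_ne_bot q))
      (Or.inl (EReal.coe_ne_top q))).2 hz
    -- Comparing with real `z` and inserting a real `c` treats infinite values of the envelope
    -- together with finite ones; `e` is the gap left over.
    obtain ⟨c, hc, hcz⟩ := EReal.lt_iff_exists_real_btwn.1 hz'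
    rw [← EReal.coe_sub, EReal.coe_lt_coe_iff] at hcz
    refine limsup_le_of_le (by isBoundedDefault) ?_
    filter_upwards [MaxPlus.Data.eventually_F_le hM hφ ht x hc (e := z - q - c) (by linarith),
      self_mem_nhdsWithin] with δ h hδ
    exact MaxPlus.Data.quotient_le hδ (by convert h using 4; ring)
  · refine EReal.ge_of_forall_gt_iff_ge.1 fun z hz => ?_
    rw [add_comm] at hz
    have hz' := (EReal.sub_lt_iff (Or.inl (EReal.coe_ne_bot q))
      (Or.inl (EReal.coe_ne_top q))).2 hz
    obtain ⟨c, hcz, hc⟩ := EReal.lt_iff_exists_real_btwn.1 hz'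
    rw [← EReal.coe_sub, EReal.coe_lt_coe_iff] at hcz
    refine le_liminf_of_le (by isBoundedDefault) ?_
    filter_upwards [MaxPlus.Data.eventually_le_F hD hM hφ ht x hc (e := c - (z - q))
      (by linarith), self_mem_nhdsWithin] with δ h hδ
    exact MaxPlus.Data.le_quotient hδ (by convert h using 4; ring)
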